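/- Let $V$ and $H$ be real Hilbert spaces with norms $\|\cdot\|$ and $|\cdot|$, $V$ densely and continuously embedded in $H$, and let $Z$ be a Banach space with $V\subset Z\subset H$ with continuous embeddings. Identify $H$ with its dual, so that $V\subset H=H'\subset V'$, and let $A:V\to V'$ be the duality map, $\langle Au,v\rangle=(u,v)_V$. Let $g\in C(V,V')$ be monotone, $\langle g(v)-g(w),v-w\rangle\ge 0$ for all $v,w\in V$, and suppose that for some $\alpha\ge 0$ $$\exists \gamma>0,\ \exists C_1\ge 0,\ \forall v\in V:\quad \langle g(v),v\rangle\ge\gamma\|v\|_Z^{\alpha+2}-C_1,$$ $$\exists K_0>0,\ \exists C_2\ge 0,\ \forall v\in V:\quad \|g(v)\|_{V'}\le C_2+K_0\|v\|_Z^{\alpha+1}.$$ Let $S^2(\mathbb R^+,H)$ be the space of $h\in L^2_{loc}(\mathbb R^+,H)$ with $\|h\|_{S^2}^2=\sup_{t\ge0}\int_t^{t+1}|h(s)|^2ds<\infty$. For $h \in L^1_{loc}(\mathbb R^+,H)$, a solution of $$\ddot u+Au+g(\dot u)=h(t),\qquad t\ge 0, \tag{1}$$ means a weak solution $u\in C(\mathbb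 R^+,V)\cap C^1(\mathbb R^+,H)$: for each $T>0$, $(u,\dot u)$ is the uniform limit on $[0,T]$, in $V\times H$, of strong solutions $(w_n,\dot w_n)\in W^{1,1}(0,T;V\times H)$ of $\ddot w_n+Aw_n+g(\dot w_n)=k_n$ (satisfied almost everywhere) with $\dot w_n(0)\in V$, $Aw_n(0)+g(\dot w_n(0))\in H$, $k_n\in C^1([0,T],H)$ and $k_n\to h$ in $L^1(0,T;H)$. Then there is a constant $K>0$, independent of $h$ and $u$, such that for every $h\in S^2(\mathbb R^+,H)$ every solution $u$ of (1) is bounded on $\mathbb R^+$ ($u$ has bounded range in $V$ and $\dot u$ has bounded range in $H$) and $$\limsup_{t\to\infty}\big(|\dot u(t)|^2+\|u(t)\|^2\big)\le K\big(1+\|h\|_{S^2}^2\big).$$ The quadratic growth is optimal in view of stationary solutions: for every $f\in H$, $f\ne 0$, there are $\delta>0$ and $c_0\in\mathbb R$ such that for all $c\ge c_0$ equation (1) with the constant forcing $h\equiv cf$ has a stationary solution $u\equiv u_0\in V$ with $$\limsup_{t\to\infty}\big(|\dot u(t)|^2+\|u(t)\|^2\big)\ge\delta\,\|h\|_{S^2}^2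 .$$ -/

import Mathlib

open MeasureTheory Set Filter Topology
open scoped NNReal

namespace DampedSecondOrder

noncomputable section

section Spaces

variable {H : Type*} [NormedAddCommGroup H]

/-- `h ∈ S²(ℝ⁺, H)`: `h` is locally square integrable on `[0, ∞)` and the integrals
of `|h|²` over the intervals `[t, t + 1]`, `t ≥ 0`, are bounded. -/
def MemS2 (h : ℝ → H) : Prop :=
  (∀ T : ℝ, MemLp h 2 (volume.restrict (Icc 0 T))) ∧
    BddAbove (range fun t : ℝ≥0 => ∫ s in (t : ℝ)..(t + 1 : ℝ), ‖h s‖ ^ 2)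

/-- The norm of `S²(ℝ⁺, H)`. -/
def s2Norm (h : ℝ → H) : ℝ :=
  Real.sqrt (⨆ t : ℝ≥0, ∫ s in (t : ℝ)..(t + 1 : ℝ), ‖h s‖ ^ 2)

/-- `f ∈ W^{1,1}(0, T; E)` with derivative `f'`: `f'` is Bochner integrable on `(0, T)`
and `f` is (the continuous representative) given by integrating `f'`. -/
def HasW11Deriv {E : Type*} [NormedAddCommGroup E] [NormedSpace ℝ E]
    (T : ℝ) (f f' : ℝ → E) : Prop :=
  IntervalIntegrable f' volume 0 T ∧ ∀ t ∈ Icc 0 T, f t = f 0 + ∫ s in (0 : ℝ)..t, f' s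

end Spaces

variable {V H : Type*} [NormedAddCommGroup V] [InnerProductSpace ℝ V] [CompleteSpace V]
  [NormedAddCommGroup H] [InnerProductSpace ℝ H]

/-- The duality map `A : V → V'`, `⟨A u, v⟩ = (u, v)_V`. -/
def dualityMap (u : V) : StrongDual ℝ V := InnerProductSpace.toDual ℝ V u

/-- The map `H = H' → V'` dual to the embedding `ι : V → H`: `⟨f, φ⟩ = (f, ι φ)_H`. -/
def toDualV (ι : V →L[ℝ] H) (f : H) : StrongDual ℝ V := (innerSL ℝ f).comp ι

/-- The domain of `𝒜 (u, v) = (-v, A u + g v)` in `V × H`: the pairs `(u, v)` with `v ∈ V`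
and `A u + g v ∈ H`. -/
def operatorDomain (ι : V →L[ℝ] H) (g : V → StrongDual ℝ V) : Set (V × H) :=
  {U | ∃ v : V, ι v = U.2 ∧ ∃ f : H, dualityMap U.1 + g v = toDualV ι f}

/-- `(w, v) ∈ W^{1,1}(0, T; V × H)` is a strong solution on `[0, T]` of `U' + 𝒜 U = (0, k)`,
that is of `w' = v`, `v' + A w + g (w') = k`. As `k` and `v'` have values in `H`, the last
equation contains that `(w t, v t)` is in the domain of `𝒜` for almost every `t`. -/
def IsStrongSolution (ι : V →L[ℝ] H) (g : V → StrongDual ℝ V) (T : ℝ) (k : ℝ → H)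
    (w : ℝ → V) (v : ℝ → H) : Prop :=
  ∃ (w' : ℝ → V) (v' : ℝ → H), HasW11Deriv T w w' ∧ HasW11Deriv T v v' ∧
    ∀ᵐ t ∂(volume.restrict (Icc 0 T)), v t = ι (w' t) ∧
      toDualV ι (v' t) + dualityMap (w t) + g (w' t) = toDualV ι (k t)

/-- The velocity `u̇` on `[0, ∞)` (one-sided at `0`), as an `H`-valued function. -/
def velocity (ι : V →L[ℝ] H) (u : ℝ → V) : ℝ → H :=
  derivWithin (fun t => ι (u t)) (Ici 0)

/-- `u ∈ C(ℝ⁺, V) ∩ C¹(ℝ⁺, H)` is a weak solution of `ü + A u + g (u̇) = h` with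
`h ∈ L¹_loc(ℝ⁺, H)`: on every `[0, T]`, the pair `(u, u̇)` is the uniform limit in `V × H` of
strong solutions that start in the domain of `𝒜` and have `C¹` forcing terms converging to `h`
in `L¹(0, T; H)`. -/
def IsWeakSolution (ι : V →L[ℝ] H) (g : V → StrongDual ℝ V) (h : ℝ → H) (u : ℝ → V) : Prop :=
  ContinuousOn u (Ici 0) ∧ ContDiffOn ℝ 1 (fun t => ι (u t)) (Ici 0) ∧
  ∀ T : ℝ, 0 < T → IntervalIntegrable h volume 0 T ∧
    ∃ (k : ℕ → ℝ → H) (w : ℕ → ℝ → V) (v : ℕ → ℝ → H),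
      (∀ n, ContDiffOn ℝ 1 (k n) (Icc 0 T) ∧ (w n 0, v n 0) ∈ operatorDomain ι g ∧
        IsStrongSolution ι g T (k n) (w n) (v n)) ∧
      Tendsto (fun n => ∫ t in (0 : ℝ)..T, ‖k n t - h t‖) atTop (𝓝 0) ∧
      TendstoUniformlyOn w u atTop (Icc 0 T) ∧
      TendstoUniformlyOn v (velocity ι u) atTop (Icc 0 T)

end

end DampedSecondOrder

/-!
Write `E = |u̇|² + ‖u‖²` and perturb half of it to `Φ = E / 2 + ε (u̇, u)_H`. The derivative of `Φ`
along a solution contains the dissipation `-γ ‖u̇‖_Z ^ (α + 2)` and the term `-ε ‖u‖²`; the only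
dangerous term is `-ε ⟨g u̇, u⟩`, of size `ε ‖u̇‖_Z ^ (α + 1) ‖u‖`. As long as `E` is at most of the
order of `R²`, it is absorbed by the two good terms if `ε` is a small multiple of
`R ^ (-α / (α + 1))`. What remains is `Φ' ≤ -(ε / 2) E + D + Q |h|²`, where the forcing is measured
against the dissipation; a balance of powers (`exists_dissipation_constants`) shows that
`D + Q ‖h‖²_{S²}` is at most `ε R² / 32` as soon as `R² ≥ R₀²` and `R² ≥ L ‖h‖²_{S²}`, with `R₀` and
`L` independent of `h` and of `u`. That the condition relates `R` to `‖h‖_{S²}` linearly, whatever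
`α` is, is the reason for the quadratic growth of the bound.

For strong solutions the inequality comes from the product rule for `W^{1,1}` functions
(`HasW11Deriv.integral_inner`). Young's inequality is applied to the limit forcing `h` only,
and the forcing `k` of the approximating problem enters through the linear term `|k - h|`; so the
inequality passes to weak solutions although the forcings converge in `L¹` only
(`IsWeakSolution.perturbedEnergy_sub_le`). A Gronwall argument on unit intervals
(`le_add_pow_floor_mul`) then shows that an energy bounded by `R²` decays to `R² / 2`
(`IsWeakSolution.energy_le`). A continuity argument turns this into boundedness
(`IsWeakSolution.energy_lt`), and applied with `R²` equal to `3 / 2` times the upper limit of `E`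
it gives the ultimate bound (`IsWeakSolution.limsup_energy_le`).

For the optimality, the stationary solution with forcing `c f` is `A⁻¹ (c f - g 0)`, whose norm
grows linearly in `c` because `f` does not vanish on the dense subspace `V`.
-/

namespace DampedSecondOrder

/-! ### Calculus of `W^{1,1}` functions -/

/-- A function is absolutely continuous if its increments are dominated by those of the primitive
of an integrable function. -/
theorem absolutelyContinuousOnInterval_of_dist_le {X : Type*} [PseudoMetricSpace X]
    {f : ℝ → X} {m : ℝ → ℝ} {a b : ℝ} (hm : IntervalIntegrable m volume a b)
    (h : ∀ x ∈ uIcc a b, ∀ y ∈ uIcc a b, dist (f x) (f y) ≤ |∫ r in x..y, m r|) :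
    AbsolutelyContinuousOnInterval f a b := by
  have hM := hm.absolutelyContinuousOnInterval_intervalIntegral (c := a) left_mem_uIcc
  rw [absolutelyContinuousOnInterval_iff] at hM ⊢
  intro ε hε
  obtain ⟨δ, hδ, hd⟩ := hM ε hε
  refine ⟨δ, hδ, fun E hE hlt => lt_of_le_of_lt (Finset.sum_le_sum fun l hl => ?_) (hd E hE hlt)⟩
  obtain ⟨hx, hy⟩ := hE.1 l hl
  refine (h _ hx _ hy).trans_eq ?_
  have hi : ∀ z ∈ uIcc a b, IntervalIntegrable m volume a z := fun z hz =>
    hm.mono_set (uIcc_subset_uIcc left_mem_uIcc hz)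
  rw [dist_comm, Real.dist_eq, intervalIntegral.integral_interval_sub_left (hi _ hy) (hi _ hx)]

section

variable {E F : Type*} [NormedAddCommGroup E] [InnerProductSpace ℝ E]
  [NormedAddCommGroup F] [NormedSpace ℝ F]

theorem HasW11Deriv.intervalIntegrable_sub {T : ℝ} {f f' : ℝ → F} (hf : HasW11Deriv T f f')
    {s t : ℝ} (hs : s ∈ Icc 0 T) (ht : t ∈ Icc 0 T) : IntervalIntegrable f' volume s t :=
  hf.1.mono_set (by
    rw [uIcc_of_le (hs.1.trans hs.2)]
    exact uIcc_subset_Icc hs ht)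

theorem HasW11Deriv.sub_eq {T : ℝ} {f f' : ℝ → F} (hf : HasW11Deriv T f f') {s t : ℝ}
    (hs : s ∈ Icc 0 T) (ht : t ∈ Icc 0 T) : f t - f s = ∫ r in s..t, f' r := by
  have h0 : (0 : ℝ) ∈ Icc 0 T := ⟨le_rfl, hs.1.trans hs.2⟩
  rw [hf.2 t ht, hf.2 s hs, ← intervalIntegral.integral_interval_sub_left
    (hf.intervalIntegrable_sub h0 ht) (hf.intervalIntegrable_sub h0 hs)]
  abel

theorem HasW11Deriv.continuousOn {T : ℝ} {f f' : ℝ → F} (hf : HasW11Deriv T f f') :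
    ContinuousOn f (Icc 0 T) := by
  rcases lt_or_ge T 0 with hT | hT
  · simp [Icc_eq_empty_of_lt hT]
  have h := intervalIntegral.continuousOn_primitive_interval'
    (hf.1) (left_mem_uIcc (a := (0 : ℝ)) (b := T))
  rw [uIcc_of_le hT] at h
  exact (continuousOn_const.add h).congr fun t ht => hf.2 t ht

theorem HasW11Deriv.ae_hasDerivAt [CompleteSpace F] {T : ℝ} {f f' : ℝ → F}
    (hf : HasW11Deriv T f f') : ∀ᵐ t, t ∈ Ioo 0 T → HasDerivAt f (f' t) t := by
  filter_upwards [hf.1.ae_hasDerivAt_integral] with t ht hmem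
  have hT : (0 : ℝ) ≤ T := (hmem.1.trans hmem.2).le
  have := (ht (by rw [uIcc_of_le hT]; exact Ioo_subset_Icc_self hmem) 0 left_mem_uIcc).const_add
    (f 0)
  refine this.congr_of_eventuallyEq ?_
  filter_upwards [isOpen_Ioo.mem_nhds hmem] with r hr
  exact hf.2 r (Ioo_subset_Icc_self hr)

theorem HasW11Deriv.comp_clm [CompleteSpace F] {G : Type*} [NormedAddCommGroup G]
    [NormedSpace ℝ G] [CompleteSpace G] {T : ℝ} {f f' : ℝ → F}
    (hf : HasW11Deriv T f f') (L : F →L[ℝ] G) :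
    HasW11Deriv T (fun t => L (f t)) (fun t => L (f' t)) := by
  refine ⟨⟨L.integrable_comp hf.1.1, L.integrable_comp hf.1.2⟩, fun t ht => ?_⟩
  have h0 : (0 : ℝ) ∈ Icc 0 T := ⟨le_rfl, ht.1.trans ht.2⟩
  change L (f t) = L (f 0) + ∫ s in (0 : ℝ)..t, L (f' s)
  rw [hf.2 t ht, map_add, L.intervalIntegral_comp_comm (hf.intervalIntegrable_sub h0 ht)]

/-- The product rule in integrated form for the inner product of two `W^{1,1}` functions. -/
theorem HasW11Deriv.integral_inner [CompleteSpace E] {T : ℝ} {f f' g g' : ℝ → E}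
    (hf : HasW11Deriv T f f') (hg : HasW11Deriv T g g') {s t : ℝ} (hs : 0 ≤ s)
    (hst : s ≤ t) (ht : t ≤ T) :
    IntervalIntegrable (fun r => inner ℝ (f r) (g' r) + inner ℝ (f' r) (g r)) volume s t ∧
    ∫ r in s..t, (inner ℝ (f r) (g' r) + inner ℝ (f' r) (g r)) =
      inner ℝ (f t) (g t) - inner ℝ (f s) (g s) := by
  have hsub : uIcc s t ⊆ Icc 0 T := by
    rw [uIcc_of_le hst]; exact Icc_subset_Icc hs ht
  have hsT : s ∈ Icc 0 T := ⟨hs, hst.trans ht⟩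
  have htT : t ∈ Icc 0 T := ⟨hs.trans hst, ht⟩
  obtain ⟨A, hA⟩ := isCompact_Icc.exists_bound_of_continuousOn hf.continuousOn
  obtain ⟨B, hB⟩ := isCompact_Icc.exists_bound_of_continuousOn hg.continuousOn
  have hA0 : 0 ≤ A := (norm_nonneg _).trans (hA s hsT)
  have hB0 : 0 ≤ B := (norm_nonneg _).trans (hB s hsT)
  have hm : IntervalIntegrable (fun r => A * ‖g' r‖ + B * ‖f' r‖) volume s t :=
    ((hg.intervalIntegrable_sub hsT htT).norm.const_mul A).add
      ((hf.intervalIntegrable_sub hsT htT).norm.const_mul B)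
  have hac : AbsolutelyContinuousOnInterval (fun r => inner ℝ (f r) (g r)) s t := by
    refine absolutelyContinuousOnInterval_of_dist_le hm ?_
    have key : ∀ x ∈ uIcc s t, ∀ y ∈ uIcc s t, x ≤ y →
        dist (inner ℝ (f x) (g x)) (inner ℝ (f y) (g y)) ≤
          |∫ r in x..y, (A * ‖g' r‖ + B * ‖f' r‖)| := by
      intro x hx y hy hxy
      refine le_trans ?_ (le_abs_self _)
      have hxT := hsub hx
      have hyT := hsub hy
      have ig := hg.intervalIntegrable_sub hxT hyT
      have jf := hf.intervalIntegrable_sub hxT hyT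
      have e : inner ℝ (f y) (g y) - inner ℝ (f x) (g x) =
          inner ℝ (f y) (g y - g x) + inner ℝ (f y - f x) (g x) := by
        rw [inner_sub_right, inner_sub_left]; ring
      have n1 : ‖g y - g x‖ ≤ ∫ r in x..y, ‖g' r‖ := by
        rw [hg.sub_eq hxT hyT]; exact intervalIntegral.norm_integral_le_integral_norm hxy
      have n2 : ‖f y - f x‖ ≤ ∫ r in x..y, ‖f' r‖ := by
        rw [hf.sub_eq hxT hyT]; exact intervalIntegral.norm_integral_le_integral_norm hxy
      rw [dist_comm, Real.dist_eq, e, intervalIntegral.integral_add (ig.norm.const_mul A)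
        (jf.norm.const_mul B), intervalIntegral.integral_const_mul,
        intervalIntegral.integral_const_mul]
      refine (abs_add_le _ _).trans (add_le_add ?_ ?_)
      · exact (abs_real_inner_le_norm _ _).trans
          (mul_le_mul (hA y hyT) n1 (norm_nonneg _) hA0)
      · refine (abs_real_inner_le_norm _ _).trans ?_
        rw [mul_comm]
        exact mul_le_mul (hB x hxT) n2 (norm_nonneg _) hB0
    intro x hx y hy
    rcases le_total x y with h | h
    · exact key x hx y hy h
    · rw [dist_comm, intervalIntegral.integral_symm, abs_neg]
      exact key y hy x hx h
  have hae : ∀ᵐ r, r ∈ uIoc s t →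
      deriv (fun r => inner ℝ (f r) (g r)) r = inner ℝ (f r) (g' r) + inner ℝ (f' r) (g r) := by
    have hne : ∀ᵐ r : ℝ, r ≠ T := by simp [ae_iff]
    filter_upwards [hf.ae_hasDerivAt, hg.ae_hasDerivAt, hne] with r h1 h2 h3 hr
    rw [uIoc_of_le hst] at hr
    have hr' : r ∈ Ioo 0 T :=
      ⟨hs.trans_lt hr.1, lt_of_le_of_ne (hr.2.trans ht) h3⟩
    exact ((h1 hr').inner ℝ (h2 hr')).deriv
  refine ⟨hac.intervalIntegrable_deriv.congr_ae ?_, ?_⟩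
  · exact (ae_restrict_iff' measurableSet_uIoc).2 hae
  · rw [← hac.integral_deriv_eq_sub]
    refine (intervalIntegral.integral_congr_ae ?_).symm
    exact hae

end

/-! ### The algebra of the perturbed energy -/

/-- Truncation at height `μ`, in place of Young's inequality. -/
theorem rpow_add_mul_rpow_le {μ z p q : ℝ} (hμ : 0 < μ) (hz : 0 ≤ z) (hp : 0 < p) (hq : 0 ≤ q) :
    z ^ p * μ ^ q ≤ z ^ (p + q) + μ ^ (p + q) := by
  have hzp : 0 ≤ z ^ p := Real.rpow_nonneg hz _
  have hμq : 0 ≤ μ ^ q := Real.rpow_nonneg hμ.le _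
  rcases le_total z μ with h | h
  · have : z ^ p * μ ^ q ≤ μ ^ p * μ ^ q :=
      mul_le_mul_of_nonneg_right (Real.rpow_le_rpow hz h hp.le) hμq
    rw [← Real.rpow_add hμ] at this
    linarith [Real.rpow_nonneg hz (p + q)]
  · have : z ^ p * μ ^ q ≤ z ^ p * z ^ q :=
      mul_le_mul_of_nonneg_left (Real.rpow_le_rpow hμ.le h hq) hzp
    rw [← Real.rpow_add (hμ.trans_le h)] at this
    linarith [Real.rpow_nonneg hμ.le (p + q)]

/-- The scalar inequality behind the ultimate bound. Here `x`, `y`, `z`, `η` stand for `‖u‖`,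
`|u̇|`, `‖u̇‖_Z`, `|h|`, and the left-hand side bounds the derivative of the perturbed energy
`(|u̇|² + ‖u‖²) / 2 + ε (u̇, u)`. At energy level `R²` the admissible perturbation is
`ε ∼ R ^ (-α / (α + 1))`, and the constants `D`, `Q` are then small compared with `ε R²` as soon as
`R²` dominates the mean square of the forcing: this gives the quadratic growth. -/
theorem exists_dissipation_constants {α γ K a b C₁ C₂ : ℝ} (hα : 0 ≤ α) (hγ : 0 < γ) (hK : 0 < K)
    (ha : 0 < a) (hb : 0 < b) (hC₁ : 0 ≤ C₁) :
    ∃ R₀ > 0, ∃ L > 0, ∀ R ≥ R₀, ∃ ε D Q : ℝ, 0 < ε ∧ ε ≤ 1 ∧ ε * b ≤ 1 / 2 ∧ 0 ≤ D ∧ 0 ≤ Q ∧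
      (∀ S ≥ 0, L * S ≤ R ^ 2 → D + Q * S ≤ ε * R ^ 2 / 32) ∧
      ∀ x y z η : ℝ, 0 ≤ x → 0 ≤ y → 0 ≤ z → 0 ≤ η → x ≤ 2 * R → y ≤ a * z →
        η * y - (γ * z ^ (α + 2) - C₁)
            + ε * (y ^ 2 - x ^ 2 + (C₂ + K * z ^ (α + 1)) * x + η * (b * x))
          ≤ -(ε / 2) * (x ^ 2 + y ^ 2) + D + Q * η ^ 2 := by
  set M : ℝ := 128 * K with hM
  have hM0 : 0 < M := by positivity
  -- `ε` will be at most `c / M`, so the bounds on `c` keep every multiple of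
  -- `‖u̇‖_Z ^ (α + 2)` that arises below a quarter of the dissipation,
  -- and give `ε ≤ 1`, `ε * b ≤ 1 / 2`
  obtain ⟨c, hc0, hc1, hc2, hc3, hc4⟩ : ∃ c : ℝ, 0 < c ∧ c ≤ γ / (8 * K) ∧
      c ≤ γ * M / (6 * a ^ 2) ∧ c ≤ M ∧ c ≤ M / (2 * b) :=
    ⟨min (min (γ / (8 * K)) (γ * M / (6 * a ^ 2))) (min M (M / (2 * b))), by positivity,
      (min_le_left _ _).trans (min_le_left _ _), (min_le_left _ _).trans (min_le_right _ _),
      (min_le_right _ _).trans (min_le_left _ _), (min_le_right _ _).trans (min_le_right _ _)⟩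
  rw [le_div_iff₀ (by positivity)] at hc1 hc2 hc4
  -- the term `η * y` is truncated at the lower height `σ * l`, so that its remainder, which is of
  -- the same order as `ε * R ^ 2`, gets a small factor
  obtain ⟨σ, hσ0, hσ1, hσ2⟩ : ∃ σ : ℝ, 0 < σ ∧ σ ≤ 1 ∧ σ ≤ c * M / (80 * γ) :=
    ⟨min 1 (c * M / (80 * γ)), by positivity, min_le_left _ _, min_le_right _ _⟩
  rw [le_div_iff₀ (by positivity)] at hσ2
  set τ : ℝ := σ ^ α with hτ
  have hτ0 : 0 < τ := Real.rpow_pos_of_pos hσ0 _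
  have hτ1 : τ ≤ 1 := Real.rpow_le_one hσ0.le hσ1 hα
  refine ⟨1 + M + 320 * C₁ / c + 640 * C₂ ^ 2 + 480 * a ^ 2, by positivity,
    1280 * b ^ 2 + 640 * a ^ 2 * M / (γ * τ * c), by positivity, fun R hR => ?_⟩
  have hR1 : 1 ≤ R := by
    have : 0 ≤ 320 * C₁ / c := by positivity
    linarith [sq_nonneg C₂, sq_nonneg a]
  have hRM : M ≤ R := by
    have : 0 ≤ 320 * C₁ / c := by positivity
    linarith [sq_nonneg C₂, sq_nonneg a]
  have hRC1 : 320 * C₁ ≤ R * c := by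
    rw [← div_le_iff₀ hc0]
    linarith [sq_nonneg C₂, sq_nonneg a]
  have hRR : R ≤ R ^ 2 := le_self_pow₀ hR1 two_ne_zero
  have hRC2 : 640 * C₂ ^ 2 ≤ R ^ 2 := by
    have : 0 ≤ 320 * C₁ / c := by positivity
    linarith [sq_nonneg C₂, sq_nonneg a]
  have hRa : 480 * a ^ 2 ≤ R ^ 2 := by
    have : 0 ≤ 320 * C₁ / c := by positivity
    linarith [sq_nonneg C₂, sq_nonneg a]
  -- `l` is the truncation height at which `K ‖u̇‖_Z ^ (α + 1)` reaches the order of `R`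
  obtain ⟨l, hl1, hlR⟩ : ∃ l : ℝ, 1 ≤ l ∧ M * l ^ (α + 1) = R := by
    refine ⟨(R / M) ^ (α + 1)⁻¹, Real.one_le_rpow ((one_le_div hM0).2 hRM) (by positivity), ?_⟩
    rw [Real.rpow_inv_rpow (by positivity) (by positivity)]
    field_simp
  have hl0 : 0 < l := by linarith
  set P : ℝ := l ^ α with hP
  have hP1 : 1 ≤ P := Real.one_le_rpow hl1 hα
  have hP0 : 0 < P := by linarith
  rw [Real.rpow_add hl0, Real.rpow_one, ← hP] at hlR
  set ε : ℝ := c / (M * P) with hε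
  have hε0 : 0 < ε := by positivity
  have hεM : ε * (M * P) = c := by rw [hε]; field_simp
  have hεR : ε * R = c * l := by rw [← hlR, ← hεM]; ring
  have hεM' : ε * M ≤ c := by
    rw [← hεM]
    exact mul_le_mul_of_nonneg_left (le_mul_of_one_le_right hM0.le hP1) hε0.le
  have hεa : ε * (6 * a ^ 2) ≤ γ := by
    have h1 : ε * M * (6 * a ^ 2) ≤ γ * M :=
      (mul_le_mul_of_nonneg_right hεM' (by positivity)).trans hc2
    refine le_of_mul_le_mul_right ?_ hM0
    linarith
  have hm : (σ * l) ^ α = τ * P := Real.mul_rpow hσ0.le hl0.le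
  refine ⟨ε, C₁ + 2 * ε * C₂ ^ 2 + 3 / 2 * ε * a ^ 2 + ε * R ^ 2 / 64
      + γ * (τ * P * (σ * l) ^ 2) / 4, 2 * ε * b ^ 2 + a ^ 2 / (γ * (τ * P)), hε0, ?_, ?_,
      by positivity, by positivity, ?_, ?_⟩
  · refine le_of_mul_le_mul_right ?_ hM0
    linarith
  · have : ε * M * (2 * b) ≤ M := (mul_le_mul_of_nonneg_right hεM' (by positivity)).trans hc4
    refine le_of_mul_le_mul_right ?_ hM0
    linarith
  · intro S hS hLS
    have h1 : C₁ ≤ ε * R ^ 2 / 320 := by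
      have : c * R ≤ ε * R ^ 2 := by
        calc c * R ≤ c * l * R :=
            mul_le_mul_of_nonneg_right (le_mul_of_one_le_right hc0.le hl1) (by linarith)
          _ = ε * R ^ 2 := by rw [← hεR]; ring
      linarith
    have h2 : 2 * ε * C₂ ^ 2 ≤ ε * R ^ 2 / 320 := by
      linarith [mul_le_mul_of_nonneg_left hRC2 hε0.le]
    have h3 : 3 / 2 * ε * a ^ 2 ≤ ε * R ^ 2 / 320 := by
      linarith [mul_le_mul_of_nonneg_left hRa hε0.le]
    have h4 : γ * (τ * P * (σ * l) ^ 2) / 4 ≤ ε * R ^ 2 / 320 := by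
      have e : ε * R ^ 2 = (c * M) * (P * l ^ 2) := by
        calc ε * R ^ 2 = (ε * R) * R := by ring
          _ = _ := by rw [hεR, ← hlR]; ring
      have h : τ * σ ^ 2 * (80 * γ) ≤ c * M := by
        have : τ * σ ^ 2 ≤ σ :=
          (mul_le_of_le_one_left (by positivity) hτ1).trans
            (pow_le_of_le_one hσ0.le hσ1 two_ne_zero)
        exact (mul_le_mul_of_nonneg_right this (by positivity)).trans hσ2
      have := mul_le_mul_of_nonneg_right h (by positivity : 0 ≤ P * l ^ 2)
      rw [e]
      linarith
    have h5 : 2 * ε * b ^ 2 * S + a ^ 2 / (γ * (τ * P)) * S ≤ ε * R ^ 2 / 640 := by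
      have := mul_le_mul_of_nonneg_left hLS hε0.le
      have e : ε * ((1280 * b ^ 2 + 640 * a ^ 2 * M / (γ * τ * c)) * S) =
          640 * (2 * ε * b ^ 2 * S + a ^ 2 / (γ * (τ * P)) * S) := by
        rw [hε]; field_simp; ring
      linarith
    have h6 : 0 ≤ ε * R ^ 2 := by positivity
    linarith
  · intro x y z η hx hy hz hη hxR hyz
    have hZ : 0 ≤ z ^ (α + 2) := Real.rpow_nonneg hz _
    have hY : 0 ≤ z ^ (α + 1) := Real.rpow_nonneg hz _
    have t1 : z ^ (α + 1) * l ≤ z ^ (α + 2) + P * l ^ 2 := by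
      have := rpow_add_mul_rpow_le hl0 hz (p := α + 1) (q := 1) (by linarith) zero_le_one
      rw [show α + 1 + 1 = α + 2 by ring, Real.rpow_one, Real.rpow_add hl0 α 2,
        Real.rpow_two] at this
      exact this
    have t2 : z ^ 2 * (τ * P) ≤ z ^ (α + 2) + τ * P * (σ * l) ^ 2 := by
      have := rpow_add_mul_rpow_le (mul_pos hσ0 hl0) hz (p := 2) (q := α) (by norm_num) hα
      rw [show 2 + α = α + 2 by ring, Real.rpow_add (mul_pos hσ0 hl0) α 2, hm, Real.rpow_two,
        Real.rpow_two] at this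
      exact this
    have t3 : z ^ 2 ≤ z ^ (α + 2) + 1 := by
      have := rpow_add_mul_rpow_le one_pos hz (p := 2) (q := α) (by norm_num) hα
      rw [show 2 + α = α + 2 by ring, Real.one_rpow, Real.one_rpow, Real.rpow_two] at this
      linarith
    set Z := z ^ (α + 2)
    set Y := z ^ (α + 1)
    have i1 : ε * (C₂ * x) ≤ ε * x ^ 2 / 8 + 2 * ε * C₂ ^ 2 := by
      linarith [mul_nonneg hε0.le (sq_nonneg (x - 4 * C₂))]
    have i2 : ε * (η * (b * x)) ≤ ε * x ^ 2 / 8 + 2 * ε * b ^ 2 * η ^ 2 := by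
      linarith [mul_nonneg hε0.le (sq_nonneg (x - 4 * (b * η)))]
    have i3 : ε * (K * Y * x) ≤ γ / 4 * Z + ε * R ^ 2 / 64 := by
      have j1 : ε * (K * Y * x) ≤ 2 * K * c * (Y * l) := by
        calc ε * (K * Y * x) ≤ ε * (K * Y * (2 * R)) := by gcongr
          _ = 2 * K * Y * (ε * R) := by ring
          _ = _ := by rw [hεR]; ring
      have j2 : 2 * K * c * (Y * l) ≤ 2 * K * c * (Z + P * l ^ 2) := by gcongr
      have j3 : ε * R ^ 2 = c * M * (P * l ^ 2) := by
        calc ε * R ^ 2 = (ε * R) * R := by ring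
          _ = _ := by rw [hεR, ← hlR]; ring
      have j4 : 2 * K * c * Z ≤ γ / 4 * Z := by
        refine mul_le_mul_of_nonneg_right ?_ hZ
        linarith
      rw [j3, hM]
      linarith
    have hy2 : y ^ 2 ≤ a ^ 2 * z ^ 2 := by
      rw [← mul_pow]; exact pow_le_pow_left₀ hy hyz 2
    have i4 : 3 / 2 * (ε * y ^ 2) ≤ γ / 4 * Z + 3 / 2 * ε * a ^ 2 := by
      have : 3 / 2 * (ε * y ^ 2) ≤ 3 / 2 * (ε * (a ^ 2 * (Z + 1))) := by
        gcongr
        exact hy2.trans (by gcongr)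
      linarith [mul_le_mul_of_nonneg_right hεa (by linarith : 0 ≤ Z)]
    have i5 : η * y ≤ γ / 4 * Z + γ * (τ * P * (σ * l) ^ 2) / 4
        + a ^ 2 / (γ * (τ * P)) * η ^ 2 := by
      have hm0 : 0 < γ * (τ * P) := by positivity
      have k1 : η * y ≤ η * (a * z) := by gcongr
      have k2 : η * (a * z) ≤ γ * (τ * P) / 4 * z ^ 2 + a ^ 2 / (γ * (τ * P)) * η ^ 2 := by
        have e : γ * (τ * P) / 4 * z ^ 2 + a ^ 2 / (γ * (τ * P)) * η ^ 2 - η * (a * z) =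
            (γ * (τ * P) * z / 2 - a * η) ^ 2 / (γ * (τ * P)) := by
          field_simp
          ring
        have : 0 ≤ (γ * (τ * P) * z / 2 - a * η) ^ 2 / (γ * (τ * P)) := by positivity
        linarith
      linarith [mul_le_mul_of_nonneg_left t2 hγ.le]
    linarith [mul_nonneg hγ.le hZ, mul_nonneg hε0.le (sq_nonneg x)]

/-! ### The energy inequality for weak solutions -/

section

variable {V H : Type*} [NormedAddCommGroup V] [InnerProductSpace ℝ V]
  [NormedAddCommGroup H] [InnerProductSpace ℝ H]

/-- The energy `(|v|² + ‖w‖²) / 2` perturbed by the small multiple `ε (v, w)_H` of the cross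
term. -/
noncomputable def perturbedEnergy (ι : V →L[ℝ] H) (ε : ℝ) (w : V) (v : H) : ℝ :=
  (‖v‖ ^ 2 + ‖w‖ ^ 2) / 2 + ε * inner ℝ v (ι w)

theorem perturbedEnergy_le {ι : V →L[ℝ] H} {b ε : ℝ} (hι : ∀ v, ‖ι v‖ ≤ b * ‖v‖) (hε : 0 ≤ ε)
    (hεb : ε * b ≤ 1 / 2) (w : V) (v : H) : perturbedEnergy ι ε w v ≤ ‖v‖ ^ 2 + ‖w‖ ^ 2 := by
  have h1 : ε * inner ℝ v (ι w) ≤ (ε * b) * (‖v‖ * ‖w‖) := by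
    calc ε * inner ℝ v (ι w) ≤ ε * (‖v‖ * (b * ‖w‖)) := by
          refine mul_le_mul_of_nonneg_left ((real_inner_le_norm _ _).trans ?_) hε
          exact mul_le_mul_of_nonneg_left (hι w) (norm_nonneg _)
      _ = _ := by ring
  have h2 := mul_le_mul_of_nonneg_right hεb (mul_nonneg (norm_nonneg v) (norm_nonneg w))
  unfold perturbedEnergy
  nlinarith [sq_nonneg (‖v‖ - ‖w‖), sq_nonneg ‖v‖, sq_nonneg ‖w‖]

theorem le_perturbedEnergy {ι : V →L[ℝ] H} {b ε : ℝ} (hι : ∀ v, ‖ι v‖ ≤ b * ‖v‖) (hε : 0 ≤ ε)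
    (hεb : ε * b ≤ 1 / 2) (w : V) (v : H) :
    ‖v‖ ^ 2 + ‖w‖ ^ 2 ≤ 4 * perturbedEnergy ι ε w v := by
  have h1 : ε * -inner ℝ v (ι w) ≤ (ε * b) * (‖v‖ * ‖w‖) := by
    calc ε * -inner ℝ v (ι w) ≤ ε * (‖v‖ * (b * ‖w‖)) := by
          refine mul_le_mul_of_nonneg_left
            (((neg_le_abs _).trans (abs_real_inner_le_norm _ _)).trans ?_) hε
          exact mul_le_mul_of_nonneg_left (hι w) (norm_nonneg _)
      _ = _ := by ring
  have h2 := mul_le_mul_of_nonneg_right hεb (mul_nonneg (norm_nonneg v) (norm_nonneg w))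
  unfold perturbedEnergy
  nlinarith [sq_nonneg (‖v‖ - ‖w‖), sq_nonneg ‖v‖, sq_nonneg ‖w‖]

/-- Dissipation of the perturbed energy at displacement level `2 R`: the left-hand side is the
derivative of `perturbedEnergy ι ε w (ι v)` along `w' = v`, `ι v' + A w + g v = k`. The forcing
`k` is compared with a reference forcing `h`, and only their difference enters without a square, as
the forcing terms of approximating strong solutions converge in `L¹` only. -/
def IsDissipativeAt (ι : V →L[ℝ] H) (g : V → StrongDual ℝ V) (R ε D Q : ℝ) : Prop :=
  ∀ (w v : V) (h k : H), ‖w‖ ≤ 2 * R →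
    inner ℝ k (ι v) - g v v + ε * (‖ι v‖ ^ 2 - ‖w‖ ^ 2 - g v w + inner ℝ k (ι w)) ≤
      -(ε / 2) * (‖w‖ ^ 2 + ‖ι v‖ ^ 2) + D + Q * ‖h‖ ^ 2 + ‖k - h‖ * (‖ι v‖ + ‖ι w‖)

/-- Coercivity and growth of `g` with respect to `‖·‖_Z` give dissipation at every large level. -/
theorem exists_isDissipativeAt {Z : Type*} [NormedAddCommGroup Z] [NormedSpace ℝ Z]
    (i : V →L[ℝ] Z) (j : Z →L[ℝ] H) {g : V → StrongDual ℝ V} {α γ K C₁ C₂ : ℝ} (hα : 0 ≤ α)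
    (hγ : 0 < γ) (hK : 0 < K) (hC₁ : 0 ≤ C₁)
    (hcoercive : ∀ v : V, γ * ‖i v‖ ^ (α + 2) - C₁ ≤ g v v)
    (hgrowth : ∀ v : V, ‖g v‖ ≤ C₂ + K * ‖i v‖ ^ (α + 1)) {b : ℝ} (hb : 0 < b)
    (hι : ∀ v, ‖j.comp i v‖ ≤ b * ‖v‖) :
    ∃ R₀ > 0, ∃ L > 0, ∀ R ≥ R₀, ∃ ε D Q : ℝ, 0 < ε ∧ ε ≤ 1 ∧ ε * b ≤ 1 / 2 ∧ 0 ≤ D ∧ 0 ≤ Q ∧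
      (∀ S ≥ 0, L * S ≤ R ^ 2 → D + Q * S ≤ ε * R ^ 2 / 32) ∧
      IsDissipativeAt (j.comp i) g R ε D Q := by
  have ha : 0 < ‖j‖ + 1 := by positivity
  obtain ⟨R₀, hR₀, L, hL, hmain⟩ :=
    exists_dissipation_constants (C₂ := C₂) hα hγ hK ha hb hC₁
  refine ⟨R₀, hR₀, L, hL, fun R hR => ?_⟩
  obtain ⟨ε, D, Q, hε, hε1, hεb, hD, hQ, hS, hpt⟩ := hmain R hR
  refine ⟨ε, D, Q, hε, hε1, hεb, hD, hQ, hS, fun w v h k hw => ?_⟩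
  have hv : ‖j.comp i v‖ ≤ (‖j‖ + 1) * ‖i v‖ := by
    refine (j.le_opNorm (i v)).trans ?_
    gcongr
    linarith
  have h1 := hpt ‖w‖ ‖j.comp i v‖ ‖i v‖ ‖h‖ (norm_nonneg _) (norm_nonneg _) (norm_nonneg _)
    (norm_nonneg _) hw hv
  have h2 := hcoercive v
  have h3 : -(g v w) ≤ (C₂ + K * ‖i v‖ ^ (α + 1)) * ‖w‖ := by
    refine (neg_le_abs _).trans (((g v).le_opNorm w).trans ?_)
    exact mul_le_mul_of_nonneg_right (hgrowth v) (norm_nonneg _)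
  have split : ∀ x : H, inner ℝ k x ≤ ‖h‖ * ‖x‖ + ‖k - h‖ * ‖x‖ := fun x => by
    have : inner ℝ k x = inner ℝ h x + inner ℝ (k - h) x := by rw [inner_sub_left]; ring
    rw [this]
    exact add_le_add (real_inner_le_norm _ _) (real_inner_le_norm _ _)
  have h4 := split (j.comp i v)
  have h5 : ε * inner ℝ k (j.comp i w) ≤
      ε * (‖h‖ * (b * ‖w‖)) + ‖k - h‖ * ‖j.comp i w‖ := by
    have e1 := mul_le_mul_of_nonneg_left (split (j.comp i w)) hε.le
    have e2 : ε * (‖h‖ * ‖j.comp i w‖) ≤ ε * (‖h‖ * (b * ‖w‖)) := by gcongr; exact hι w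
    have e3 : ε * (‖k - h‖ * ‖j.comp i w‖) ≤ ‖k - h‖ * ‖j.comp i w‖ :=
      mul_le_of_le_one_left (by positivity) hε1
    linarith
  have h6 := mul_le_mul_of_nonneg_left h3 hε.le
  linarith

variable [CompleteSpace V]

/-- The energy inequality in integrated form for strong solutions. -/
theorem IsStrongSolution.perturbedEnergy_sub_le [CompleteSpace H] {ι : V →L[ℝ] H}
    {g : V → StrongDual ℝ V} {T : ℝ} {k h : ℝ → H} {w : ℝ → V} {v : ℝ → H}
    (hw : IsStrongSolution ι g T k w v)
    {R ε D Q M s t : ℝ} (hdiss : IsDissipativeAt ι g R ε D Q) (hs : 0 ≤ s) (hst : s ≤ t)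
    (ht : t ≤ T) (hk : IntervalIntegrable k volume s t) (hh : IntervalIntegrable h volume s t)
    (hh2 : IntervalIntegrable (fun r => ‖h r‖ ^ 2) volume s t)
    (hR : ∀ r ∈ Icc s t, ‖w r‖ ≤ 2 * R) (hM : ∀ r ∈ Icc s t, ‖v r‖ + ‖ι (w r)‖ ≤ M) :
    perturbedEnergy ι ε (w t) (v t) - perturbedEnergy ι ε (w s) (v s) ≤
      -(ε / 2) * (∫ r in s..t, (‖w r‖ ^ 2 + ‖v r‖ ^ 2)) + D * (t - s)
        + Q * (∫ r in s..t, ‖h r‖ ^ 2) + M * ∫ r in s..t, ‖k r - h r‖ := by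
  obtain ⟨w', v', hw', hv', hae⟩ := hw
  have hιw := hw'.comp_clm ι
  obtain ⟨i1, e1⟩ := hv'.integral_inner hv' hs hst ht
  obtain ⟨i2, e2⟩ := hw'.integral_inner hw' hs hst ht
  obtain ⟨i3, e3⟩ := hv'.integral_inner hιw hs hst ht
  have hsub : Icc s t ⊆ Icc 0 T := Icc_subset_Icc hs ht
  have hE : IntervalIntegrable (fun r => ‖w r‖ ^ 2 + ‖v r‖ ^ 2) volume s t := by
    apply ContinuousOn.intervalIntegrable
    rw [uIcc_of_le hst]
    exact ((hw'.continuousOn.mono hsub).norm.pow 2).add ((hv'.continuousOn.mono hsub).norm.pow 2)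
  have hkh : IntervalIntegrable (fun r => ‖k r - h r‖) volume s t := (hk.sub hh).norm
  have hc : IntervalIntegrable (fun _ : ℝ => D) volume s t := intervalIntegrable_const
  have e4 : perturbedEnergy ι ε (w t) (v t) - perturbedEnergy ι ε (w s) (v s) =
      ∫ r in s..t, ((1 / 2) * (inner ℝ (v r) (v' r) + inner ℝ (v' r) (v r)) +
        (1 / 2) * (inner ℝ (w r) (w' r) + inner ℝ (w' r) (w r)) +
        ε * (inner ℝ (v r) (ι (w' r)) + inner ℝ (v' r) (ι (w r)))) := by
    rw [intervalIntegral.integral_add ((i1.const_mul _).add (i2.const_mul _)) (i3.const_mul _),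
      intervalIntegral.integral_add (i1.const_mul _) (i2.const_mul _),
      intervalIntegral.integral_const_mul, intervalIntegral.integral_const_mul,
      intervalIntegral.integral_const_mul, e1, e2, e3]
    simp only [perturbedEnergy, real_inner_self_eq_norm_sq]
    ring
  have e5 : -(ε / 2) * (∫ r in s..t, (‖w r‖ ^ 2 + ‖v r‖ ^ 2)) + D * (t - s)
        + Q * (∫ r in s..t, ‖h r‖ ^ 2) + M * (∫ r in s..t, ‖k r - h r‖) =
      ∫ r in s..t, (-(ε / 2) * (‖w r‖ ^ 2 + ‖v r‖ ^ 2) + D + Q * ‖h r‖ ^ 2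
        + M * ‖k r - h r‖) := by
    rw [intervalIntegral.integral_add (((hE.const_mul _).add hc).add (hh2.const_mul _))
        (hkh.const_mul _),
      intervalIntegral.integral_add ((hE.const_mul _).add hc) (hh2.const_mul _),
      intervalIntegral.integral_add (hE.const_mul _) hc, intervalIntegral.integral_const_mul,
      intervalIntegral.integral_const_mul, intervalIntegral.integral_const_mul,
      intervalIntegral.integral_const, smul_eq_mul]
    ring
  rw [e4, e5]
  -- pointwise, the equation is tested with `w'` for the energy and with `w` for the cross term
  refine intervalIntegral.integral_mono_ae_restrict hst
    (((i1.const_mul _).add (i2.const_mul _)).add (i3.const_mul _))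
    ((((hE.const_mul _).add hc).add (hh2.const_mul _)).add (hkh.const_mul _)) ?_
  filter_upwards [ae_restrict_of_ae_restrict_of_subset hsub hae,
    ae_restrict_mem measurableSet_Icc] with r ⟨hr1, hr2⟩ hr
  have f1 := congrArg (fun φ : StrongDual ℝ V => φ (w' r)) hr2
  have f2 := congrArg (fun φ : StrongDual ℝ V => φ (w r)) hr2
  simp only [toDualV, dualityMap, add_apply, ContinuousLinearMap.comp_apply,
    innerSL_apply_apply, InnerProductSpace.toDual_apply_apply] at f1 f2
  have f3 := hdiss (w r) (w' r) (h r) (k r) (hR r hr)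
  have f4 := mul_le_mul_of_nonneg_left (hM r hr) (norm_nonneg (k r - h r))
  rw [hr1] at f4 ⊢
  rw [real_inner_comm (v' r) (ι (w' r)), real_inner_comm (w r) (w' r),
    real_inner_self_eq_norm_sq]
  rw [real_inner_self_eq_norm_sq] at f2
  have f5 : inner ℝ (v' r) (ι (w' r)) = inner ℝ (k r) (ι (w' r)) - inner ℝ (w r) (w' r)
    - g (w' r) (w' r) := by linarith
  have f6 : inner ℝ (v' r) (ι (w r)) = inner ℝ (k r) (ι (w r)) - ‖w r‖ ^ 2 - g (w' r) (w r) := by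
    linarith
  rw [f5, f6]
  linarith

theorem IsWeakSolution.continuousOn_velocity {ι : V →L[ℝ] H} {g : V → StrongDual ℝ V} {h : ℝ → H}
    {u : ℝ → V} (hu : IsWeakSolution ι g h u) : ContinuousOn (velocity ι u) (Ici 0) :=
  hu.2.1.continuousOn_derivWithin (uniqueDiffOn_Ici 0) le_rfl

/-- The energy inequality survives the passage from strong to weak solutions. -/
theorem IsWeakSolution.perturbedEnergy_sub_le [CompleteSpace H] {ι : V →L[ℝ] H}
    {g : V → StrongDual ℝ V} {h : ℝ → H} {u : ℝ → V} (hu : IsWeakSolution ι g h u)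
    {R ε D Q s t : ℝ} (hR0 : 0 < R)
    (hdiss : IsDissipativeAt ι g R ε D Q) (hs : 0 ≤ s) (hst : s ≤ t)
    (hh2 : IntervalIntegrable (fun r => ‖h r‖ ^ 2) volume s t)
    (hR : ∀ r ∈ Icc s t, ‖u r‖ ≤ R) :
    perturbedEnergy ι ε (u t) (velocity ι u t) - perturbedEnergy ι ε (u s) (velocity ι u s) ≤
      -(ε / 2) * (∫ r in s..t, (‖u r‖ ^ 2 + ‖velocity ι u r‖ ^ 2)) + D * (t - s)
        + Q * ∫ r in s..t, ‖h r‖ ^ 2 := by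
  have hsub0 : Icc s t ⊆ Ici 0 := fun r hr => hs.trans hr.1
  have hT : 0 < t + 1 := by linarith
  obtain ⟨hh, k, w, v, hsol, hk, hw, hv⟩ := hu.2.2 (t + 1) hT
  have hsub : Icc s t ⊆ Icc 0 (t + 1) := Icc_subset_Icc hs (by linarith)
  have hsubu : uIcc s t ⊆ uIcc 0 (t + 1) := by rwa [uIcc_of_le hst, uIcc_of_le hT.le]
  obtain ⟨N, hN⟩ := isCompact_Icc.exists_bound_of_continuousOn
    (hu.continuousOn_velocity.mono hsub0)
  have hN0 : 0 ≤ N := (norm_nonneg _).trans (hN s ⟨le_rfl, hst⟩)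
  have hwR : ∀ᶠ n in atTop, ∀ r ∈ Icc s t, ‖w n r‖ ≤ 2 * R := by
    filter_upwards [Metric.tendstoUniformlyOn_iff.1 hw R hR0] with n hn r hr
    have h1 := hn r (hsub hr)
    rw [dist_eq_norm] at h1
    have h2 := norm_le_norm_add_norm_sub (u r) (w n r)
    linarith [hR r hr]
  have hvN : ∀ᶠ n in atTop, ∀ r ∈ Icc s t, ‖v n r‖ ≤ N + 1 := by
    filter_upwards [Metric.tendstoUniformlyOn_iff.1 hv 1 one_pos] with n hn r hr
    have h1 := hn r (hsub hr)
    rw [dist_eq_norm] at h1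
    have h2 := norm_le_norm_add_norm_sub (velocity ι u r) (v n r)
    linarith [hN r hr]
  have hwl : ∀ r ∈ Icc s t, Tendsto (fun n => w n r) atTop (𝓝 (u r)) := fun r hr =>
    hw.tendsto_at (hsub hr)
  have hvl : ∀ r ∈ Icc s t, Tendsto (fun n => v n r) atTop (𝓝 (velocity ι u r)) := fun r hr =>
    hv.tendsto_at (hsub hr)
  have hki : ∀ n, IntervalIntegrable (k n) volume 0 (t + 1) := fun n =>
    ContinuousOn.intervalIntegrable (by rw [uIcc_of_le hT.le]; exact (hsol n).1.continuousOn)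
  have hhs := hh.mono_set hsubu
  set M : ℝ := N + 1 + ‖ι‖ * (2 * R)
  have hineq : ∀ᶠ n in atTop,
      perturbedEnergy ι ε (w n t) (v n t) - perturbedEnergy ι ε (w n s) (v n s) ≤
      -(ε / 2) * (∫ r in s..t, (‖w n r‖ ^ 2 + ‖v n r‖ ^ 2)) + D * (t - s)
        + Q * (∫ r in s..t, ‖h r‖ ^ 2) + M * ∫ r in (0 : ℝ)..(t + 1), ‖k n r - h r‖ := by
    filter_upwards [hwR, hvN] with n h1 h2
    refine ((hsol n).2.2.perturbedEnergy_sub_le hdiss hs hst (by linarith)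
      ((hki n).mono_set hsubu) hhs hh2 h1 (M := M) fun r hr => ?_).trans ?_
    · exact add_le_add (h2 r hr) ((ι.le_opNorm _).trans
        (mul_le_mul_of_nonneg_left (h1 r hr) (norm_nonneg _)))
    · gcongr
      exact intervalIntegral.integral_mono_interval hs hst (by linarith)
        (Eventually.of_forall fun r => norm_nonneg _) ((hki n).sub hh).norm
  have hEl : Tendsto (fun n => ∫ r in s..t, (‖w n r‖ ^ 2 + ‖v n r‖ ^ 2)) atTop
      (𝓝 (∫ r in s..t, (‖u r‖ ^ 2 + ‖velocity ι u r‖ ^ 2))) := by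
    refine intervalIntegral.tendsto_integral_filter_of_dominated_convergence
      (fun _ => (2 * R) ^ 2 + (N + 1) ^ 2) (Eventually.of_forall fun n => ?_) ?_
      intervalIntegrable_const (Eventually.of_forall fun r hr => ?_)
    · obtain ⟨w', v', hw', hv', -⟩ := (hsol n).2.2
      have : ContinuousOn (fun r => ‖w n r‖ ^ 2 + ‖v n r‖ ^ 2) (Icc s t) :=
        ((hw'.continuousOn.mono hsub).norm.pow 2).add ((hv'.continuousOn.mono hsub).norm.pow 2)
      rw [uIoc_of_le hst]
      exact (this.mono Ioc_subset_Icc_self).aestronglyMeasurable measurableSet_Ioc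
    · filter_upwards [hwR, hvN] with n h1 h2
      refine Eventually.of_forall fun r hr => ?_
      rw [uIoc_of_le hst] at hr
      have hr' := Ioc_subset_Icc_self hr
      rw [Real.norm_of_nonneg (by positivity)]
      exact add_le_add (pow_le_pow_left₀ (norm_nonneg _) (h1 r hr') 2)
        (pow_le_pow_left₀ (norm_nonneg _) (h2 r hr') 2)
    · rw [uIoc_of_le hst] at hr
      have hr' := Ioc_subset_Icc_self hr
      exact ((hwl r hr').norm.pow 2).add ((hvl r hr').norm.pow 2)
  have hΦ : ∀ r ∈ Icc s t, Tendsto (fun n => perturbedEnergy ι ε (w n r) (v n r)) atTop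
      (𝓝 (perturbedEnergy ι ε (u r) (velocity ι u r))) := fun r hr =>
    ((((hvl r hr).norm.pow 2).add ((hwl r hr).norm.pow 2)).div_const 2).add
      (((hvl r hr).inner ((ι.continuous.tendsto _).comp (hwl r hr))).const_mul ε)
  have hlim := (((hEl.const_mul (-(ε / 2))).add_const (D * (t - s))).add_const
    (Q * ∫ r in s..t, ‖h r‖ ^ 2)).add (hk.const_mul M)
  rw [mul_zero, add_zero] at hlim
  exact le_of_tendsto_of_tendsto ((hΦ t ⟨hst, le_rfl⟩).sub (hΦ s ⟨le_rfl, hst⟩)) hlim hineq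

end

/-! ### From the energy inequality to the ultimate bound -/

/-- A discrete Gronwall argument. If `Φ` loses `k ∫ E` up to an error `B` on intervals of length at
most one, and `Φ ≤ E`, then each unit step contracts `Φ` by the factor `1 / (1 + k)` up to `B`. -/
theorem le_add_pow_floor_mul {Φ E : ℝ → ℝ} {a c k B : ℝ} (hk : 0 < k) (hB : 0 ≤ B)
    (hE : ContinuousOn E (Icc a c)) (hE0 : ∀ t ∈ Icc a c, 0 ≤ E t)
    (hΦE : ∀ t ∈ Icc a c, Φ t ≤ E t)
    (h : ∀ s t, a ≤ s → s ≤ t → t ≤ c → t ≤ s + 1 → Φ t - Φ s ≤ -k * (∫ r in s..t, E r) + B)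
    {t : ℝ} (ht : t ∈ Icc a c) :
    Φ t ≤ B * (1 + k) / k + (1 / (1 + k)) ^ ⌊t - a⌋₊ * (Φ a + B) := by
  have short : ∀ s t, a ≤ s → s ≤ t → t ≤ c → t ≤ s + 1 → Φ t ≤ Φ s + B := by
    intro s t hs hst htc hts
    have h1 := h s t hs hst htc hts
    have h2 : 0 ≤ ∫ r in s..t, E r := intervalIntegral.integral_nonneg hst fun r hr =>
      hE0 r ⟨hs.trans hr.1, hr.2.trans htc⟩
    nlinarith
  have step : ∀ s, a ≤ s → s + 1 ≤ c → Φ (s + 1) ≤ 1 / (1 + k) * Φ s + B := by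
    intro s hs hsc
    have h1 := h s (s + 1) hs (by linarith) hsc le_rfl
    have h2 : Φ (s + 1) - B ≤ ∫ r in s..s + 1, E r := by
      have : ∫ _ in s..s + 1, (Φ (s + 1) - B) ≤ ∫ r in s..s + 1, E r := by
        refine intervalIntegral.integral_mono_on (by linarith) intervalIntegrable_const
          (ContinuousOn.intervalIntegrable ?_) fun r hr => ?_
        · rw [uIcc_of_le (by linarith)]
          exact hE.mono (Icc_subset_Icc hs hsc)
        · have h3 := short r (s + 1) (hs.trans hr.1) hr.2 hsc (by linarith [hr.1])
          have h4 := hΦE r ⟨hs.trans hr.1, hr.2.trans hsc⟩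
          linarith
      simpa using this
    have h5 := mul_le_mul_of_nonneg_left h2 hk.le
    have h6 : Φ (s + 1) * (1 + k) ≤ (1 / (1 + k) * Φ s + B) * (1 + k) := by
      have : (1 / (1 + k) * Φ s + B) * (1 + k) = Φ s + B * (1 + k) := by field_simp
      rw [this]
      linarith
    exact le_of_mul_le_mul_right h6 (by linarith)
  have iter : ∀ n : ℕ, ∀ s, a ≤ s → s + n ≤ c →
      Φ (s + n) ≤ B * (1 + k) / k + (1 / (1 + k)) ^ n * Φ s := by
    intro n
    induction n with
    | zero =>
      intro s hs hsc
      have : 0 ≤ B * (1 + k) / k := by positivity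
      simpa using this
    | succ n ih =>
      intro s hs hsc
      push_cast at hsc ⊢
      have h1 := step (s + n) (by linarith [(Nat.cast_nonneg n : (0 : ℝ) ≤ n)]) (by linarith)
      have h2 := mul_le_mul_of_nonneg_left (ih s hs (by linarith))
        (by positivity : 0 ≤ 1 / (1 + k))
      have h3 : 1 / (1 + k) * (B * (1 + k) / k + (1 / (1 + k)) ^ n * Φ s) + B =
          B * (1 + k) / k + (1 / (1 + k)) ^ (n + 1) * Φ s := by
        rw [pow_succ]
        field_simp
        ring
      rw [← add_assoc]
      linarith
  have hn := Nat.floor_le (sub_nonneg.2 ht.1)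
  have hn' := (Nat.lt_floor_add_one (t - a)).le
  have h1 := iter ⌊t - a⌋₊ (t - ⌊t - a⌋₊) (by linarith) (by linarith [ht.2])
  rw [sub_add_cancel] at h1
  have h2 := short a (t - ⌊t - a⌋₊) le_rfl (by linarith)
    (by linarith [ht.2, (Nat.cast_nonneg ⌊t - a⌋₊ : (0 : ℝ) ≤ ⌊t - a⌋₊)]) (by linarith)
  refine h1.trans ?_
  gcongr

section

variable {H : Type*} [NormedAddCommGroup H]

theorem sq_s2Norm (h : ℝ → H) :
    s2Norm h ^ 2 = ⨆ t : ℝ≥0, ∫ s in (t : ℝ)..(t + 1 : ℝ), ‖h s‖ ^ 2 := by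
  refine Real.sq_sqrt (Real.iSup_nonneg fun t => ?_)
  exact intervalIntegral.integral_nonneg (by linarith) fun r _ => by positivity

theorem MemS2.intervalIntegrable_norm_sq {h : ℝ → H} (hh : MemS2 h) {s t : ℝ} (hs : 0 ≤ s)
    (hst : s ≤ t) : IntervalIntegrable (fun r => ‖h r‖ ^ 2) volume s t := by
  rw [intervalIntegrable_iff_integrableOn_Ioc_of_le hst]
  exact IntegrableOn.mono_set (hh.1 t).norm.integrable_sq
    (Ioc_subset_Icc_self.trans (Icc_subset_Icc_left hs))

theorem MemS2.integral_norm_sq_le {h : ℝ → H} (hh : MemS2 h) {s t : ℝ} (hs : 0 ≤ s)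
    (hst : s ≤ t) (hts : t ≤ s + 1) : ∫ r in s..t, ‖h r‖ ^ 2 ≤ s2Norm h ^ 2 := by
  rw [sq_s2Norm]
  exact (intervalIntegral.integral_mono_interval le_rfl hst hts
    (Eventually.of_forall fun r => by positivity)
    (hh.intervalIntegrable_norm_sq hs (by linarith))).trans (le_ciSup hh.2 ⟨s, hs⟩)

theorem memS2_const (f : H) : MemS2 (fun _ : ℝ => f) :=
  ⟨fun _ => memLp_const f, ⟨‖f‖ ^ 2, by rintro _ ⟨t, rfl⟩; simp⟩⟩

theorem sq_s2Norm_const (f : H) : s2Norm (fun _ : ℝ => f) ^ 2 = ‖f‖ ^ 2 := by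
  simp [sq_s2Norm]

end

section

variable {V H : Type*} [NormedAddCommGroup V] [InnerProductSpace ℝ V] [CompleteSpace V]
  [NormedAddCommGroup H] [InnerProductSpace ℝ H]

theorem IsWeakSolution.continuousOn_energy {ι : V →L[ℝ] H} {g : V → StrongDual ℝ V} {h : ℝ → H}
    {u : ℝ → V} (hu : IsWeakSolution ι g h u) :
    ContinuousOn (fun t => ‖velocity ι u t‖ ^ 2 + ‖u t‖ ^ 2) (Ici 0) :=
  (hu.continuousOn_velocity.norm.pow 2).add (hu.1.norm.pow 2)

/-- While the energy stays below a level `R²` at which the damping dominates the forcing, it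
decays below half of that level, at a geometric rate. -/
theorem IsWeakSolution.energy_le [CompleteSpace H] {ι : V →L[ℝ] H}
    {g : V → StrongDual ℝ V} {h : ℝ → H} {u : ℝ → V} (hu : IsWeakSolution ι g h u)
    (hh : MemS2 h) {b R ε D Q : ℝ}
    (hι : ∀ v, ‖ι v‖ ≤ b * ‖v‖) (hR : 0 < R) (hε : 0 < ε) (hε1 : ε ≤ 1) (hεb : ε * b ≤ 1 / 2)
    (hD : 0 ≤ D) (hQ : 0 ≤ Q) (hDQ : D + Q * s2Norm h ^ 2 ≤ ε * R ^ 2 / 32)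
    (hdiss : IsDissipativeAt ι g R ε D Q) {a c : ℝ} (ha : 0 ≤ a)
    (hE : ∀ t ∈ Icc a c, ‖velocity ι u t‖ ^ 2 + ‖u t‖ ^ 2 ≤ R ^ 2) {t : ℝ} (ht : t ∈ Icc a c) :
    ‖velocity ι u t‖ ^ 2 + ‖u t‖ ^ 2 ≤ 3 / 8 * R ^ 2 + (1 / (1 + ε / 2)) ^ ⌊t - a⌋₊ *
      (4 * (‖velocity ι u a‖ ^ 2 + ‖u a‖ ^ 2) + R ^ 2 / 8) := by
  set B : ℝ := D + Q * s2Norm h ^ 2 with hB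
  have hB0 : 0 ≤ B := by positivity
  have hmain := le_add_pow_floor_mul (Φ := fun t => perturbedEnergy ι ε (u t) (velocity ι u t))
    (E := fun t => ‖velocity ι u t‖ ^ 2 + ‖u t‖ ^ 2) (half_pos hε) hB0
    (hu.continuousOn_energy.mono fun r hr => ha.trans hr.1) (fun r _ => by positivity)
    (fun r _ => perturbedEnergy_le hι hε.le hεb _ _)
    (fun s t hs hst htc hts => by
      have h1 := hu.perturbedEnergy_sub_le hR hdiss (ha.trans hs) hst
        (hh.intervalIntegrable_norm_sq (ha.trans hs) hst) fun r hr => by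
          refine le_of_sq_le_sq ?_ hR.le
          have := hE r ⟨hs.trans hr.1, hr.2.trans htc⟩
          linarith [sq_nonneg ‖velocity ι u r‖]
      have h2 := mul_le_mul_of_nonneg_left
        (hh.integral_norm_sq_le (ha.trans hs) hst hts) hQ
      have h3 : D * (t - s) ≤ D := mul_le_of_le_one_right hD (by linarith)
      simp only [add_comm (‖velocity ι u _‖ ^ 2)]
      linarith) ht
  have h1 := le_perturbedEnergy hι hε.le hεb (u t) (velocity ι u t)
  have h2 := perturbedEnergy_le hι hε.le hεb (u a) (velocity ι u a)
  have h3 : B * (1 + ε / 2) / (ε / 2) ≤ 3 / 32 * R ^ 2 := by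
    rw [div_le_iff₀ (by positivity)]
    nlinarith
  have h4 : B ≤ R ^ 2 / 32 := by nlinarith [sq_nonneg R]
  have h5 : (1 / (1 + ε / 2)) ^ ⌊t - a⌋₊ * (perturbedEnergy ι ε (u a) (velocity ι u a) + B) ≤
      (1 / (1 + ε / 2)) ^ ⌊t - a⌋₊ * (‖velocity ι u a‖ ^ 2 + ‖u a‖ ^ 2 + R ^ 2 / 32) := by
    gcongr
  linarith

/-- A weak solution whose energy starts well below `R²` never reaches `R²`: at the first time at
which it would, `IsWeakSolution.energy_le` puts it strictly below. -/
theorem IsWeakSolution.energy_lt [CompleteSpace H] {ι : V →L[ℝ] H}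
    {g : V → StrongDual ℝ V} {h : ℝ → H} {u : ℝ → V} (hu : IsWeakSolution ι g h u)
    (hh : MemS2 h) {b R ε D Q : ℝ}
    (hι : ∀ v, ‖ι v‖ ≤ b * ‖v‖) (hR : 0 < R) (hε : 0 < ε) (hε1 : ε ≤ 1) (hεb : ε * b ≤ 1 / 2)
    (hD : 0 ≤ D) (hQ : 0 ≤ Q) (hDQ : D + Q * s2Norm h ^ 2 ≤ ε * R ^ 2 / 32)
    (hdiss : IsDissipativeAt ι g R ε D Q)
    (h0 : 8 * (‖velocity ι u 0‖ ^ 2 + ‖u 0‖ ^ 2) < R ^ 2) {t : ℝ} (ht : 0 ≤ t) :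
    ‖velocity ι u t‖ ^ 2 + ‖u t‖ ^ 2 < R ^ 2 := by
  by_contra! hcon
  set E : ℝ → ℝ := fun t => ‖velocity ι u t‖ ^ 2 + ‖u t‖ ^ 2 with hEdef
  have hEc : ContinuousOn E (Icc 0 t) := hu.continuousOn_energy.mono Icc_subset_Ici_self
  have hE00 : 0 ≤ E 0 := by positivity
  have hE0 : E 0 ≤ R ^ 2 := by
    change 8 * E 0 < R ^ 2 at h0
    linarith
  have hcomp : IsCompact (Icc 0 t ∩ E ⁻¹' {R ^ 2}) :=
    isCompact_Icc.of_isClosed_subset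
      (hEc.preimage_isClosed_of_isClosed isClosed_Icc isClosed_singleton) inter_subset_left
  obtain ⟨x, hx, hxE⟩ := intermediate_value_Icc ht hEc ⟨hE0, hcon⟩
  obtain ⟨t₀, ⟨ht₀, ht₀E⟩, hleast⟩ := hcomp.exists_isLeast ⟨x, hx, hxE⟩
  have hle : ∀ r ∈ Icc 0 t₀, E r ≤ R ^ 2 := by
    intro r hr
    by_contra! hlt
    obtain ⟨y, hy, hyE⟩ := intermediate_value_Icc hr.1
      (hEc.mono (Icc_subset_Icc_right (hr.2.trans ht₀.2))) ⟨hE0, hlt.le⟩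
    have h1 := hleast ⟨⟨hy.1, hy.2.trans (hr.2.trans ht₀.2)⟩, hyE⟩
    have h2 : r = t₀ := le_antisymm hr.2 (h1.trans hy.2)
    rw [h2] at hlt
    exact hlt.ne' ht₀E
  have h1 := hu.energy_le hh hι hR hε hε1 hεb hD hQ hDQ hdiss le_rfl hle ⟨ht₀.1, le_rfl⟩
  have h2 : (1 / (1 + ε / 2)) ^ ⌊t₀ - 0⌋₊ * (4 * E 0 + R ^ 2 / 8) ≤ 4 * E 0 + R ^ 2 / 8 := by
    refine mul_le_of_le_one_left (by positivity) (pow_le_one₀ (by positivity) ?_)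
    rw [div_le_one (by positivity)]
    linarith
  have h3 : E t₀ = R ^ 2 := ht₀E
  change 8 * E 0 < R ^ 2 at h0
  change E t₀ ≤ 3 / 8 * R ^ 2 + (1 / (1 + ε / 2)) ^ ⌊t₀ - 0⌋₊ * (4 * E 0 + R ^ 2 / 8) at h1
  have h4 : 0 < R ^ 2 := by positivity
  linarith

/-- An eventual bound `R²` of the energy improves to `R² / 2` in the limit. -/
theorem IsWeakSolution.limsup_energy_le [CompleteSpace H] {ι : V →L[ℝ] H}
    {g : V → StrongDual ℝ V} {h : ℝ → H} {u : ℝ → V} (hu : IsWeakSolution ι g h u)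
    (hh : MemS2 h) {b R ε D Q : ℝ}
    (hι : ∀ v, ‖ι v‖ ≤ b * ‖v‖) (hR : 0 < R) (hε : 0 < ε) (hε1 : ε ≤ 1) (hεb : ε * b ≤ 1 / 2)
    (hD : 0 ≤ D) (hQ : 0 ≤ Q) (hDQ : D + Q * s2Norm h ^ 2 ≤ ε * R ^ 2 / 32)
    (hdiss : IsDissipativeAt ι g R ε D Q)
    (hE : ∀ᶠ t in atTop, ‖velocity ι u t‖ ^ 2 + ‖u t‖ ^ 2 ≤ R ^ 2) :
    limsup (fun t => ‖velocity ι u t‖ ^ 2 + ‖u t‖ ^ 2) atTop ≤ R ^ 2 / 2 := by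
  obtain ⟨a, ha⟩ := eventually_atTop.1 (hE.and (eventually_ge_atTop 0))
  have ha0 : 0 ≤ a := (ha a le_rfl).2
  set C : ℝ := 4 * (‖velocity ι u a‖ ^ 2 + ‖u a‖ ^ 2) + R ^ 2 / 8
  have hfloor : Tendsto (fun t : ℝ => ⌊t - a⌋₊) atTop atTop :=
    tendsto_nat_floor_atTop.comp (tendsto_atTop_add_const_right _ (-a) tendsto_id)
  have hlim : Tendsto (fun t : ℝ => (1 / (1 + ε / 2)) ^ ⌊t - a⌋₊ * C) atTop (𝓝 (0 * C)) := by
    refine Tendsto.mul_const C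
      ((tendsto_pow_atTop_nhds_zero_of_lt_one (by positivity) ?_).comp hfloor)
    rw [div_lt_one (by positivity)]
    linarith
  rw [zero_mul] at hlim
  refine limsup_le_of_le
    (isCoboundedUnder_le_of_le atTop (x := 0) fun t => by positivity) ?_
  filter_upwards [hlim.eventually (ge_mem_nhds (by positivity : 0 < R ^ 2 / 8)),
    eventually_ge_atTop a] with t ht hat
  have h1 := hu.energy_le hh hι hR hε hε1 hεb hD hQ hDQ hdiss (c := t) ha0
    (fun r hr => (ha r hr.1).1) ⟨hat, le_rfl⟩
  change _ ≤ 3 / 8 * R ^ 2 + (1 / (1 + ε / 2)) ^ ⌊t - a⌋₊ * C at h1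
  linarith

end

/-! ### Stationary solutions -/

section

variable {V H : Type*} [NormedAddCommGroup V] [InnerProductSpace ℝ V]
  [NormedAddCommGroup H] [InnerProductSpace ℝ H]

theorem velocity_const (ι : V →L[ℝ] H) (u₀ : V) : velocity ι (fun _ => u₀) = 0 := by
  funext t
  simp [velocity]

theorem toDualV_ne_zero {ι : V →L[ℝ] H} (hι : DenseRange ι) {f : H} (hf : f ≠ 0) :
    toDualV ι f ≠ 0 := by
  intro h0
  refine hf (hι.eq_zero_of_inner_left (𝕜 := ℝ) fun y => ?_)
  simpa [toDualV] using congrArg (fun φ : StrongDual ℝ V => φ y) h0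

/-- An equilibrium is a strong solution, hence its own approximating sequence. -/
theorem isWeakSolution_const [CompleteSpace V] {ι : V →L[ℝ] H} {g : V → StrongDual ℝ V} {f : H}
    {u₀ : V}
    (hu₀ : dualityMap u₀ + g 0 = toDualV ι f) :
    IsWeakSolution ι g (fun _ => f) (fun _ => u₀) := by
  refine ⟨continuousOn_const, contDiffOn_const, fun T hT => ⟨intervalIntegrable_const,
    fun _ _ => f, fun _ _ => u₀, fun _ _ => 0, fun _ => ⟨contDiffOn_const,
      ⟨0, map_zero _, f, hu₀⟩, fun _ => 0, fun _ => 0, ?_, ?_, ?_⟩, ?_, ?_, ?_⟩⟩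
  · exact ⟨intervalIntegrable_const, fun t _ => by simp⟩
  · exact ⟨intervalIntegrable_const, fun t _ => by simp⟩
  · refine Eventually.of_forall fun t => ⟨(map_zero ι).symm, ?_⟩
    have : toDualV ι (0 : H) = 0 := by ext; simp [toDualV]
    rw [this, zero_add, hu₀]
  · simp
  · exact Metric.tendstoUniformlyOn_iff.2 fun ε hε =>
      Eventually.of_forall fun n x _ => by simpa using hε
  · rw [velocity_const]
    exact Metric.tendstoUniformlyOn_iff.2 fun ε hε =>
      Eventually.of_forall fun n x _ => by simpa using hε

end

end DampedSecondOrder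

theorem theorem4p1
    {V H Z : Type*}
    [NormedAddCommGroup V] [InnerProductSpace ℝ V] [CompleteSpace V]
    [NormedAddCommGroup H] [InnerProductSpace ℝ H] [CompleteSpace H]
    [NormedAddCommGroup Z] [NormedSpace ℝ Z] [CompleteSpace Z]
    -- continuous embeddings `V ⊂ Z ⊂ H`, with `V` dense in `H`
    (i : V →L[ℝ] Z) (j : Z →L[ℝ] H)
    (hi : Function.Injective i) (hj : Function.Injective j)
    (hdense : DenseRange (j.comp i))
    (g : V → StrongDual ℝ V) (hg : Continuous g)
    (hmono : ∀ v w : V, 0 ≤ (g v - g w) (v - w))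
    (α : ℝ) (hα : 0 ≤ α)
    (hcoercive : ∃ γ > 0, ∃ C₁ ≥ 0, ∀ v : V, γ * ‖i v‖ ^ (α + 2) - C₁ ≤ g v v)
    (hgrowth : ∃ K > 0, ∃ C₂ ≥ 0, ∀ v : V, ‖g v‖ ≤ C₂ + K * ‖i v‖ ^ (α + 1)) :
    -- boundedness and the ultimate bound, with `K` independent of `h` and `u`
    (∃ K > 0, ∀ h : ℝ → H, DampedSecondOrder.MemS2 h →
      ∀ u : ℝ → V, DampedSecondOrder.IsWeakSolution (j.comp i) g h u →
        Bornology.IsBounded (u '' Ici 0) ∧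
        Bornology.IsBounded (DampedSecondOrder.velocity (j.comp i) u '' Ici 0) ∧
        limsup (fun t => ‖DampedSecondOrder.velocity (j.comp i) u t‖ ^ 2 + ‖u t‖ ^ 2) atTop
          ≤ K * (1 + DampedSecondOrder.s2Norm h ^ 2)) ∧
    -- optimality: constant forcing terms `c • f` have stationary solutions of quadratic energy
    (∀ f : H, f ≠ 0 → ∃ δ > 0, ∃ c₀ : ℝ, ∀ c ≥ c₀, ∃ u₀ : V,
      DampedSecondOrder.MemS2 (fun _ : ℝ => c • f) ∧
      DampedSecondOrder.IsWeakSolution (j.comp i) g (fun _ => c • f) (fun _ => u₀) ∧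
      δ * DampedSecondOrder.s2Norm (fun _ : ℝ => c • f) ^ 2 ≤
        limsup (fun t : ℝ => ‖DampedSecondOrder.velocity (j.comp i) (fun _ => u₀) t‖ ^ 2
          + ‖u₀‖ ^ 2) atTop) := by
  obtain ⟨γ, hγ, C₁, hC₁, hco⟩ := hcoercive
  obtain ⟨K, hK, C₂, -, hgr⟩ := hgrowth
  refine ⟨?_, fun f hf => ?_⟩
  · have hb : 0 < ‖j.comp i‖ + 1 := by positivity
    have hι : ∀ v, ‖j.comp i v‖ ≤ (‖j.comp i‖ + 1) * ‖v‖ := fun v =>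
      ((j.comp i).le_opNorm v).trans (by gcongr; linarith)
    obtain ⟨R₀, hR₀, L, hL, hR⟩ :=
      DampedSecondOrder.exists_isDissipativeAt i j hα hγ hK hC₁ hco hgr hb hι
    refine ⟨R₀ ^ 2 + L, by positivity, fun h hh u hu => ?_⟩
    set S : ℝ := DampedSecondOrder.s2Norm h ^ 2
    have hS : 0 ≤ S := sq_nonneg _
    set E : ℝ → ℝ := fun t => ‖DampedSecondOrder.velocity (j.comp i) u t‖ ^ 2 + ‖u t‖ ^ 2
    have hE0 : ∀ t, 0 ≤ E t := fun t => by positivity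
    obtain ⟨R, hR0, hRE⟩ : ∃ R > 0, ∀ t ≥ 0, E t < R ^ 2 := by
      set R : ℝ := √(R₀ ^ 2 + L * S + 8 * E 0 + 1)
      have hR2 : R ^ 2 = R₀ ^ 2 + L * S + 8 * E 0 + 1 :=
        Real.sq_sqrt (by have := hE0 0; positivity)
      have hLS : 0 ≤ L * S := by positivity
      have hRR₀ : R₀ ≤ R := Real.le_sqrt_of_sq_le (by linarith [hE0 0])
      have hR0 : 0 < R := by linarith
      obtain ⟨ε, D, Q, hε, hε1, hεb, hD, hQ, hDQ, hdiss⟩ := hR R hRR₀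
      refine ⟨R, hR0, fun t ht => hu.energy_lt hh hι hR0 hε hε1 hεb hD hQ
        (hDQ S hS ?_) hdiss ?_ ht⟩
      · linarith [hE0 0, sq_nonneg R₀]
      · change 8 * E 0 < R ^ 2
        linarith [sq_nonneg R₀]
    refine ⟨?_, ?_, ?_⟩
    · refine isBounded_iff_forall_norm_le.2 ⟨R, ?_⟩
      rintro _ ⟨t, ht, rfl⟩
      refine le_of_sq_le_sq ?_ hR0.le
      exact (le_add_of_nonneg_left (sq_nonneg _)).trans (hRE t ht).le
    · refine isBounded_iff_forall_norm_le.2 ⟨R, ?_⟩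
      rintro _ ⟨t, ht, rfl⟩
      refine le_of_sq_le_sq ?_ hR0.le
      exact (le_add_of_nonneg_right (sq_nonneg _)).trans (hRE t ht).le
    · -- If the upper limit `m` were larger, the level `R² = 3 m / 2` would eventually bound the
      -- energy, and hence so would `R² / 2 < m` in the limit.
      by_contra! hm
      set m : ℝ := limsup E atTop
      have hLS : 0 ≤ L * S := by positivity
      have hm' : R₀ ^ 2 + L * S < m := by
        have : (0 : ℝ) ≤ R₀ ^ 2 * S := by positivity
        change (R₀ ^ 2 + L) * (1 + S) < m at hm
        linarith
      have hm0 : 0 < m := lt_of_le_of_lt (by positivity) hm'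
      have hρ2 : √(3 / 2 * m) ^ 2 = 3 / 2 * m := Real.sq_sqrt (by positivity)
      have hρR₀ : R₀ ≤ √(3 / 2 * m) := Real.le_sqrt_of_sq_le (by linarith)
      have hbdd : IsBoundedUnder (· ≤ ·) atTop E := ⟨R ^ 2, by
        rw [eventually_map]
        filter_upwards [eventually_ge_atTop 0] with t ht using (hRE t ht).le⟩
      have hev : ∀ᶠ t in atTop, E t < 3 / 2 * m :=
        eventually_lt_of_limsup_lt (by change m < _; linarith) hbdd
      obtain ⟨ε, D, Q, hε, hε1, hεb, hD, hQ, hDQ, hdiss⟩ := hR _ hρR₀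
      have hlim : m ≤ √(3 / 2 * m) ^ 2 / 2 := hu.limsup_energy_le hh hι
        (lt_of_lt_of_le hR₀ hρR₀) hε hε1 hεb hD hQ
        (hDQ S hS (by rw [hρ2]; linarith [sq_nonneg R₀])) hdiss
        (by rw [hρ2]; exact hev.mono fun t ht => ht.le)
      rw [hρ2] at hlim
      linarith
  · set p : ℝ := ‖DampedSecondOrder.toDualV (j.comp i) f‖
    have hp : 0 < p := norm_pos_iff.2 (DampedSecondOrder.toDualV_ne_zero hdense hf)
    have hf0 : 0 < ‖f‖ := norm_pos_iff.2 hf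
    refine ⟨p ^ 2 / (4 * ‖f‖ ^ 2), by positivity, 2 * ‖g 0‖ / p, fun c hc => ?_⟩
    have hc0 : 0 ≤ c := le_trans (by positivity) hc
    rw [ge_iff_le, div_le_iff₀ hp] at hc
    set φ : StrongDual ℝ V := DampedSecondOrder.toDualV (j.comp i) (c • f) - g 0 with hφ
    have hφp : c * p / 2 ≤ ‖φ‖ := by
      have h1 : DampedSecondOrder.toDualV (j.comp i) (c • f) =
          c • DampedSecondOrder.toDualV (j.comp i) f := by
        ext v
        simp [DampedSecondOrder.toDualV]
      have h2 : ‖DampedSecondOrder.toDualV (j.comp i) (c • f)‖ = c * p := by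
        rw [h1, norm_smul, Real.norm_of_nonneg hc0]
      have h3 := norm_sub_norm_le (DampedSecondOrder.toDualV (j.comp i) (c • f)) (g 0)
      rw [h2, ← hφ] at h3
      linarith
    refine ⟨(InnerProductSpace.toDual ℝ V).symm φ, DampedSecondOrder.memS2_const _,
      DampedSecondOrder.isWeakSolution_const ?_, ?_⟩
    · rw [DampedSecondOrder.dualityMap, LinearIsometryEquiv.apply_symm_apply, hφ, sub_add_cancel]
    · rw [DampedSecondOrder.velocity_const, DampedSecondOrder.sq_s2Norm_const]
      simp only [Pi.zero_apply]
      rw [limsup_const, LinearIsometryEquiv.norm_map, norm_smul, Real.norm_of_nonneg hc0]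
      have h4 : (c * p / 2) ^ 2 ≤ ‖φ‖ ^ 2 := pow_le_pow_left₀ (by positivity) hφp 2
      have h5 : p ^ 2 / (4 * ‖f‖ ^ 2) * (c * ‖f‖) ^ 2 = (c * p / 2) ^ 2 := by
        field_simp
        ring
      rw [h5]
      simpa using h4
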